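/- Let $d\in\{2,3\}$ and let $\Omega\subset\mathbb{R}^d$ be a bounded domain with boundary $\Gamma=\partial\Omega$ of class $C^{k,1}$ for some $k\ge 1$ and outward unit normal $\mathbf n$. Let $\varepsilon,\delta,K,T>0$, $\kappa\ge 0$, $s_1,s_2\in\mathbb{R}$, let $N\ge 1$ be an integer, $\tau=T/N$, and let $F,G\in C^2(\mathbb{R})$ have second derivatives that are bounded above. Consider functions $\phi^n$ on $\Omega$ and $\psi^n$ on $\Gamma$ ($0\le n\le N$), and $\mu^n$ on $\Omega$ and $\mu_\Gamma^n$ on $\Gamma$ ($1\le n\le N$), that satisfy, for $0\le n<N$, the stabilized semi-implicit scheme $$\frac{\phi^{n+1}-\phi^n}{\tau}=\Delta\mu^{n+1}\ \text{ in }\Omega,\qquad \mu^{n+1}=-\varepsilon\Delta\phi^{n+1}+\frac1\varepsilon F'(\phi^n)+s_1(\phi^{n+1}-\phi^n)\ \text{ in }\Omega,$$ $$K\partial_{\mathbf n}\mu^{n+1}=\mu_\Gamma^{n+1}-\mu^{n+1}\ \text{ on }\Gamma,\qquad \phi^{n+1}|_\Gamma=\psi^{n+1}\ \text{ on }\Gamma,$$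 $$\frac{\psi^{n+1}-\psi^n}{\tau}=\Delta_\Gamma\mu_\Gamma^{n+1}-\partial_{\mathbf n}\mu^{n+1}\ \text{ on }\Gamma,$$ $$\mu_\Gamma^{n+1}=-\delta\kappa\Delta_\Gamma\psi^{n+1}+\frac1\delta G'(\psi^n)+\varepsilon\partial_{\mathbf n}\phi^{n+1}+s_2(\psi^{n+1}-\psi^n)\ \text{ on }\Gamma,$$ where also the initial data are compatible, $\phi^0|_\Gamma=\psi^0$. Here $\phi^n,\mu^n\in H^1(\Omega)$ and $\psi^n,\mu_\Gamma^n\in H^1(\Gamma)$; the functions $\Delta\phi^n,\Delta\mu^n$ (for $n\ge1$) lie in $L^2(\Omega)$ and $\partial_{\mathbf n}\phi^n,\partial_{\mathbf n}\mu^n,\Delta_\Gamma\psi^n,\Delta_\Gamma\mu_\Gamma^n$ (for $n\ge 1$) in $L^2(\Gamma)$; these operators are understood in the weak sense, restrictions to $\Gamma$ in the sense of traces, and the equations hold almost everywhere. For all $0\le n\le N$, $F(\phi^n)$ and $G(\psi^n)$ are integrable over $\Omega$ and $\Gamma$, so that the energy $$E(\phi^n,\psi^n)=\int_\Omega \frac1\varepsilon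 F(\phi^n)+\frac\varepsilon2|\nabla\phi^n|^2\,dx+\int_\Gamma\frac1\delta G(\psi^n)+\frac{\delta\kappa}2|\nabla_\Gamma\psi^n|^2\,dS$$ is finite. If $$s_1\ge\frac1{2\varepsilon}\sup_{\xi\in\mathbb{R}}F''(\xi),\qquad s_2\ge\frac1{2\delta}\sup_{\eta\in\mathbb{R}}G''(\eta),$$ then, for every $0\le n<N$ and with no restriction on the size of $\tau$, $$\frac{E(\phi^{n+1},\psi^{n+1})-E(\phi^n,\psi^n)}{\tau}\le-\|\nabla\mu^{n+1}\|^2_{L^2(\Omega)}-\|\nabla_\Gamma\mu_\Gamma^{n+1}\|^2_{L^2(\Gamma)}-\frac1K\|\mu^{n+1}-\mu_\Gamma^{n+1}\|^2_{L^2(\Gamma)},$$ and in particular $E(\phi^{n+1},\psi^{n+1})\le E(\phi^n,\psi^n)$. -/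

import Mathlib

open MeasureTheory Filter Topology Set
open scoped ContDiff

noncomputable section

namespace CahnHilliard

/-- The Euclidean space in which the domain lives. -/
abbrev Space (d : ℕ) := EuclideanSpace ℝ (Fin d)

variable {d : ℕ}

/-! ### Domains with regular boundary -/

/-- `h` is of class `C^{k,1}`: it is `C^k` and its derivatives of order `k` are Lipschitz. -/
def IsOfClassCkLip {V : Type*} [NormedAddCommGroup V] [NormedSpace ℝ V] (k : ℕ) (h : V → ℝ) :
    Prop :=
  ContDiff ℝ k h ∧ ∃ L : NNReal, LipschitzWith L (iteratedFDeriv ℝ k h)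

/-- A bounded domain whose boundary is of class `C^{k,1}`: near every boundary point, and in
suitable Cartesian coordinates (height in the direction of a unit vector `a`, the other coordinates
in the hyperplane orthogonal to `a`), the set is the part below the graph of a `C^{k,1}` function. -/
structure IsBoundedDomainOfClass (k : ℕ) (Ω : Set (Space d)) : Prop where
  isOpen : IsOpen Ω
  isConnected : IsConnected Ω
  isBounded : Bornology.IsBounded Ω
  graph : ∀ x₀ ∈ frontier Ω, ∃ (a : Space d) (h : (ℝ ∙ a)ᗮ → ℝ) (r : ℝ),
    ‖a‖ = 1 ∧ IsOfClassCkLip k h ∧ 0 < r ∧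
      ∀ x ∈ Metric.ball x₀ r, (x ∈ Ω ↔ inner ℝ a x < h ((ℝ ∙ a)ᗮ.orthogonalProjectionOnto x))

/-- Lebesgue measure on `Ω`. -/
abbrev bulkMeasure (Ω : Set (Space d)) : Measure (Space d) := volume.restrict Ω

/-- Surface measure on `Γ = ∂Ω`: the `(d-1)`-dimensional Hausdorff measure, normalized so that it
is Lebesgue measure on hyperplanes. -/
abbrev surfaceMeasure (Ω : Set (Space d)) : Measure (Space d) :=
  (Measure.euclideanHausdorffMeasure (d - 1)).restrict (frontier Ω)

/-! ### Bulk operators -/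

/-- `p ∈ L²(Ω; ℝᵈ)` is the weak gradient of `u` in `Ω`. -/
def HasWeakGradient (Ω : Set (Space d)) (u : Space d → ℝ) (p : Space d → Space d) : Prop :=
  MemLp p 2 (bulkMeasure Ω) ∧
    ∀ ζ : Space d → ℝ, ContDiff ℝ ∞ ζ → HasCompactSupport ζ → tsupport ζ ⊆ Ω →
      ∫ x in Ω, u x • gradient ζ x = - ∫ x in Ω, ζ x • p x

/-- The Sobolev space `H¹(Ω)`. -/
def MemH1 (Ω : Set (Space d)) (u : Space d → ℝ) : Prop :=
  MemLp u 2 (bulkMeasure Ω) ∧ ∃ p, HasWeakGradient Ω u p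

/-- The weak gradient `∇u` (unique almost everywhere) of `u ∈ H¹(Ω)`. -/
def weakGradient (Ω : Set (Space d)) (u : Space d → ℝ) : Space d → Space d :=
  Classical.epsilon (HasWeakGradient Ω u)

/-- `f ∈ L²(Ω)` is the distributional Laplacian of `u ∈ H¹(Ω)`. -/
def HasWeakLaplacian (Ω : Set (Space d)) (u f : Space d → ℝ) : Prop :=
  MemLp f 2 (bulkMeasure Ω) ∧
    ∀ ζ : Space d → ℝ, ContDiff ℝ ∞ ζ → HasCompactSupport ζ → tsupport ζ ⊆ Ω →
      ∫ x in Ω, f x * ζ x = - ∫ x in Ω, inner ℝ (weakGradient Ω u x) (gradient ζ x)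

/-- The Laplacian `Δu ∈ L²(Ω)` (unique almost everywhere), if there is one. -/
def weakLaplacian (Ω : Set (Space d)) (u : Space d → ℝ) : Space d → ℝ :=
  Classical.epsilon (HasWeakLaplacian Ω u)

/-- `g ∈ L²(Γ)` is the trace of `u ∈ H¹(Ω)`, the trace operator being the continuous extension of
the restriction `w ↦ w|_Γ` from functions that are smooth up to the boundary: some smooth functions
`w j` converge to `u` in `H¹(Ω)` and their restrictions to `Γ` converge to `g` in `L²(Γ)`. -/
def HasTrace (Ω : Set (Space d)) (u g : Space d → ℝ) : Prop :=
  MemLp g 2 (surfaceMeasure Ω) ∧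
    ∃ w : ℕ → Space d → ℝ, (∀ j, ContDiff ℝ ∞ (w j)) ∧
      Tendsto (fun j => eLpNorm (w j - u) 2 (bulkMeasure Ω)) atTop (𝓝 0) ∧
      Tendsto (fun j => eLpNorm (gradient (w j) - weakGradient Ω u) 2 (bulkMeasure Ω))
        atTop (𝓝 0) ∧
      Tendsto (fun j => eLpNorm (w j - g) 2 (surfaceMeasure Ω)) atTop (𝓝 0)

/-- The trace `u|_Γ ∈ L²(Γ)` (unique almost everywhere on `Γ`). -/
def trace (Ω : Set (Space d)) (u : Space d → ℝ) : Space d → ℝ :=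
  Classical.epsilon (HasTrace Ω u)

/-- `g ∈ L²(Γ)` is the outward normal derivative of a function `u ∈ H¹(Ω)` with `Δu ∈ L²(Ω)`, in
the usual sense for such functions (whose gradient need not have a trace). -/
def HasNormalDeriv (Ω : Set (Space d)) (u g : Space d → ℝ) : Prop :=
  MemLp g 2 (surfaceMeasure Ω) ∧
    ∀ ζ : Space d → ℝ, ContDiff ℝ ∞ ζ →
      ∫ x, g x * ζ x ∂(surfaceMeasure Ω) =
        ∫ x in Ω, (inner ℝ (weakGradient Ω u x) (gradient ζ x) + weakLaplacian Ω u x * ζ x)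

/-- The normal derivative `∂ₙu ∈ L²(Γ)` (unique almost everywhere on `Γ`), if there is one. -/
def normalDeriv (Ω : Set (Space d)) (u : Space d → ℝ) : Space d → ℝ :=
  Classical.epsilon (HasNormalDeriv Ω u)

/-- The bulk functions for which all terms of the scheme make sense in `L²`: `u ∈ H¹(Ω)` with
trace in `L²(Γ)`, with `Δu ∈ L²(Ω)` and with `∂ₙu ∈ L²(Γ)`. -/
structure IsBulkRegular (Ω : Set (Space d)) (u : Space d → ℝ) : Prop where
  memH1 : MemH1 Ω u
  trace : ∃ g, HasTrace Ω u g
  laplacian : ∃ f, HasWeakLaplacian Ω u f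
  normalDeriv : ∃ g, HasNormalDeriv Ω u g

/-! ### Surface operators -/

/-- The tangent space of `Γ = ∂Ω` at `x`, as a linear subspace of `ℝᵈ`. -/
def tangentSpaceBoundary (Ω : Set (Space d)) (x : Space d) : Submodule ℝ (Space d) :=
  Submodule.span ℝ (tangentConeAt ℝ (frontier Ω) x)

/-- The tangential gradient on `Γ` of (the restriction of) a smooth function on `ℝᵈ`: the
orthogonal projection of its gradient to the tangent space. -/
def smoothSurfaceGradient (Ω : Set (Space d)) (w : Space d → ℝ) (x : Space d) : Space d :=
  (tangentSpaceBoundary Ω x).starProjection (gradient w x)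

/-- `p ∈ L²(Γ; ℝᵈ)` is the tangential gradient of `v ∈ L²(Γ)`: some smooth functions `w j`
converge to `v` in `L²(Γ)` and their tangential gradients converge to `p` in `L²(Γ)`. -/
def HasSurfaceGradient (Ω : Set (Space d)) (v : Space d → ℝ) (p : Space d → Space d) : Prop :=
  MemLp p 2 (surfaceMeasure Ω) ∧
    ∃ w : ℕ → Space d → ℝ, (∀ j, ContDiff ℝ ∞ (w j)) ∧
      (∀ j, MemLp (smoothSurfaceGradient Ω (w j)) 2 (surfaceMeasure Ω)) ∧
      Tendsto (fun j => eLpNorm (w j - v) 2 (surfaceMeasure Ω)) atTop (𝓝 0) ∧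
      Tendsto (fun j => eLpNorm (smoothSurfaceGradient Ω (w j) - p) 2 (surfaceMeasure Ω))
        atTop (𝓝 0)

/-- The Sobolev space `H¹(Γ)`. -/
def MemH1Surface (Ω : Set (Space d)) (v : Space d → ℝ) : Prop :=
  MemLp v 2 (surfaceMeasure Ω) ∧ ∃ p, HasSurfaceGradient Ω v p

/-- The tangential gradient `∇_Γ v` (unique almost everywhere on `Γ`) of `v ∈ H¹(Γ)`. -/
def surfaceGradient (Ω : Set (Space d)) (v : Space d → ℝ) : Space d → Space d :=
  Classical.epsilon (HasSurfaceGradient Ω v)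

/-- `f ∈ L²(Γ)` is the Laplace-Beltrami operator applied to `v ∈ H¹(Γ)`, in the sense of
distributions on the closed hypersurface `Γ`. -/
def HasLaplaceBeltrami (Ω : Set (Space d)) (v f : Space d → ℝ) : Prop :=
  MemLp f 2 (surfaceMeasure Ω) ∧
    ∀ ζ : Space d → ℝ, ContDiff ℝ ∞ ζ →
      ∫ x, f x * ζ x ∂(surfaceMeasure Ω) =
        - ∫ x, inner ℝ (surfaceGradient Ω v x) (smoothSurfaceGradient Ω ζ x) ∂(surfaceMeasure Ω)

/-- `Δ_Γ v ∈ L²(Γ)` (unique almost everywhere on `Γ`), if there is one. -/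
def laplaceBeltrami (Ω : Set (Space d)) (v : Space d → ℝ) : Space d → ℝ :=
  Classical.epsilon (HasLaplaceBeltrami Ω v)

/-- The surface functions for which all terms of the scheme make sense in `L²`: `v ∈ H¹(Γ)` with
`Δ_Γ v ∈ L²(Γ)`. -/
structure IsSurfaceRegular (Ω : Set (Space d)) (v : Space d → ℝ) : Prop where
  memH1 : MemH1Surface Ω v
  laplaceBeltrami : ∃ f, HasLaplaceBeltrami Ω v f

/-! ### Energy and scheme -/

/-- The total free energy `E(φ, ψ)`, bulk plus surface. -/
def energy (Ω : Set (Space d)) (F G : ℝ → ℝ) (ε δ κ : ℝ) (φ ψ : Space d → ℝ) : ℝ :=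
  (∫ x in Ω, ((1 / ε) * F (φ x) + ε / 2 * ‖weakGradient Ω φ x‖ ^ 2)) +
    ∫ x, ((1 / δ) * G (ψ x) + δ * κ / 2 * ‖surfaceGradient Ω ψ x‖ ^ 2) ∂(surfaceMeasure Ω)

/-- `(φ, ψ)` is a state of finite energy: `φ ∈ H¹(Ω)`, `ψ ∈ H¹(Γ)`, the potential energies are
finite, and `ψ` is the trace of `φ`. -/
structure IsFiniteEnergyState (Ω : Set (Space d)) (F G : ℝ → ℝ) (φ ψ : Space d → ℝ) : Prop where
  bulk : MemH1 Ω φ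
  surface : MemH1Surface Ω ψ
  bulk_potential : Integrable (fun x => F (φ x)) (bulkMeasure Ω)
  surface_potential : Integrable (fun x => G (ψ x)) (surfaceMeasure Ω)
  bulk_trace : ∃ g, HasTrace Ω φ g
  trace_eq : ∀ᵐ x ∂(surfaceMeasure Ω), trace Ω φ x = ψ x

/-- One time step of the stabilized semi-implicit scheme, from `(φ, ψ)` to `(φ', ψ')`, with new
chemical potentials `μ` in `Ω` and `μΓ` on `Γ`. -/
structure IsSchemeStep (Ω : Set (Space d)) (F G : ℝ → ℝ) (ε δ κ K s₁ s₂ τ : ℝ)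
    (φ ψ φ' ψ' μ μΓ : Space d → ℝ) : Prop where
  bulk_evolution : ∀ᵐ x ∂(bulkMeasure Ω), (φ' x - φ x) / τ = weakLaplacian Ω μ x
  bulk_potential : ∀ᵐ x ∂(bulkMeasure Ω),
    μ x = -ε * weakLaplacian Ω φ' x + (1 / ε) * deriv F (φ x) + s₁ * (φ' x - φ x)
  robin : ∀ᵐ x ∂(surfaceMeasure Ω), K * normalDeriv Ω μ x = μΓ x - trace Ω μ x
  trace_eq : ∀ᵐ x ∂(surfaceMeasure Ω), trace Ω φ' x = ψ' x
  surface_evolution : ∀ᵐ x ∂(surfaceMeasure Ω),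
    (ψ' x - ψ x) / τ = laplaceBeltrami Ω μΓ x - normalDeriv Ω μ x
  surface_potential : ∀ᵐ x ∂(surfaceMeasure Ω),
    μΓ x = -δ * κ * laplaceBeltrami Ω ψ' x + (1 / δ) * deriv G (ψ x) + ε * normalDeriv Ω φ' x
      + s₂ * (ψ' x - ψ x)

/-- `(φⁿ, ψⁿ)`, `0 ≤ n ≤ N`, and `(μⁿ, μΓⁿ)`, `1 ≤ n ≤ N`, solve the scheme with `N` time steps of
size `τ`; the values of the sequences at other indices play no role. -/
structure IsSchemeSolution (Ω : Set (Space d)) (F G : ℝ → ℝ) (ε δ κ K s₁ s₂ τ : ℝ) (N : ℕ)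
    (φ ψ μ μΓ : ℕ → Space d → ℝ) : Prop where
  state : ∀ n ≤ N, IsFiniteEnergyState Ω F G (φ n) (ψ n)
  phi_regular : ∀ n < N, IsBulkRegular Ω (φ (n + 1))
  psi_regular : ∀ n < N, IsSurfaceRegular Ω (ψ (n + 1))
  mu_regular : ∀ n < N, IsBulkRegular Ω (μ (n + 1))
  muΓ_regular : ∀ n < N, IsSurfaceRegular Ω (μΓ (n + 1))
  step : ∀ n < N, IsSchemeStep Ω F G ε δ κ K s₁ s₂ τ (φ n) (ψ n) (φ (n + 1)) (ψ (n + 1))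
    (μ (n + 1)) (μΓ (n + 1))

end CahnHilliard

end

open CahnHilliard

/-! Test the evolution equations with `μ` and `μΓ`, and the potential equations with the increments
of `φ` and `ψ`. The implicit Dirichlet terms are convex, so their increments are bounded by their
derivative at the new state times the increment. The potentials are explicit: Taylor's inequality
leaves a quadratic error with constant half the supremum of the second derivative, which the
stabilization absorbs (`integral_energy_sub_le`).

Green's identities (`integral_normalDeriv_mul`, `integral_laplaceBeltrami_mul`) turn the Laplacians
into these Dirichlet terms. Since `ψ` is the trace of `φ` at both time levels, the bulk boundary
term with `ε ∂ₙφ'` cancels the one in the surface potential. The evolution equations then give `τ`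
times the two gradient dissipations plus a boundary term with `∂ₙμ`, which the Robin condition makes
the `1/K` dissipation. As `τ` enters only as a positive factor, its size is free. -/

namespace CahnHilliard

/-! ### Pairings and limits in `L²` -/

section Convergence

variable {α H : Type*} [MeasurableSpace α] {ν : Measure α} [NormedAddCommGroup H]

/-- The extended norms may be infinite at finitely many indices, so membership is only eventual. -/
theorem eventually_memLp_of_tendsto {f : ℕ → α → H} {g : α → H}
    (hf : ∀ j, AEStronglyMeasurable (f j) ν) (hg : MemLp g 2 ν)
    (h : Tendsto (fun j => eLpNorm (f j - g) 2 ν) atTop (𝓝 0)) :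
    ∀ᶠ j in atTop, MemLp (f j) 2 ν := by
  filter_upwards [h.eventually_lt_const ENNReal.zero_lt_top] with j hj
  have hsub : MemLp (f j - g) 2 ν := ⟨(hf j).sub hg.1, hj⟩
  simpa using hsub.add hg

variable [InnerProductSpace ℝ H]

theorem integrable_inner_of_memLp {p q : α → H} (hp : MemLp p 2 ν) (hq : MemLp q 2 ν) :
    Integrable (fun x => inner ℝ (p x) (q x)) ν := by
  refine (hp.norm.integrable_mul hq.norm).mono' (hp.1.inner hq.1)
    (Eventually.of_forall fun x => ?_)
  exact norm_inner_le_norm (p x) (q x)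

theorem integrable_mul_of_memLp {p q : α → ℝ} (hp : MemLp p 2 ν) (hq : MemLp q 2 ν) :
    Integrable (fun x => p x * q x) ν :=
  hp.integrable_mul hq

/-- Convergence in `L²` implies convergence of the pairing with a fixed element of `L²`. -/
theorem tendsto_integral_inner {p : α → H} {f : ℕ → α → H} {g : α → H} (hp : MemLp p 2 ν)
    (hf : ∀ j, AEStronglyMeasurable (f j) ν) (hg : MemLp g 2 ν)
    (h : Tendsto (fun j => eLpNorm (f j - g) 2 ν) atTop (𝓝 0)) :
    Tendsto (fun j => ∫ x, inner ℝ (p x) (f j x) ∂ν) atTop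
      (𝓝 (∫ x, inner ℝ (p x) (g x) ∂ν)) := by
  refine tendsto_integral_of_L1' _ (integrable_inner_of_memLp hp hg).aestronglyMeasurable ?_ ?_
  · filter_upwards [eventually_memLp_of_tendsto hf hg h] with j hj
    exact integrable_inner_of_memLp hp hj
  · have hbound : ∀ j, eLpNorm ((fun x => inner ℝ (p x) (f j x)) - fun x => inner ℝ (p x) (g x))
        1 ν ≤ eLpNorm p 2 ν * eLpNorm (f j - g) 2 ν := by
      intro j
      have := eLpNorm_le_eLpNorm_mul_eLpNorm'_of_norm (p := 2) (q := 2) (r := 1) hp.1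
        ((hf j).sub hg.1) (fun a b => inner ℝ a b) 1
        (Eventually.of_forall fun x => by
          simpa using norm_inner_le_norm (𝕜 := ℝ) (p x) ((f j - g) x))
      simp only [ENNReal.coe_one, one_mul] at this
      refine le_trans (le_of_eq ?_) this
      congr 1
      ext x
      simp [inner_sub_right]
    refine tendsto_of_tendsto_of_tendsto_of_le_of_le tendsto_const_nhds ?_ (fun _ => zero_le)
      hbound
    simpa using ENNReal.Tendsto.const_mul h (Or.inr hp.2.ne)

theorem tendsto_integral_mul {p : α → ℝ} {f : ℕ → α → ℝ} {g : α → ℝ} (hp : MemLp p 2 ν)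
    (hf : ∀ j, AEStronglyMeasurable (f j) ν) (hg : MemLp g 2 ν)
    (h : Tendsto (fun j => eLpNorm (f j - g) 2 ν) atTop (𝓝 0)) :
    Tendsto (fun j => ∫ x, p x * f j x ∂ν) atTop (𝓝 (∫ x, p x * g x ∂ν)) := by
  simpa [mul_comm] using tendsto_integral_inner hp hf hg h

end Convergence

/-! ### Green's identities by density -/

section Green

variable {d : ℕ} {Ω : Set (Space d)} {u v f g : Space d → ℝ}

theorem continuous_gradient_of_contDiff {w : Space d → ℝ} (hw : ContDiff ℝ ∞ w) :
    Continuous (gradient w) :=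
  (InnerProductSpace.toDual ℝ (Space d)).symm.continuous.comp (hw.continuous_fderiv (by simp))

theorem MemH1.hasWeakGradient (hu : MemH1 Ω u) : HasWeakGradient Ω u (weakGradient Ω u) :=
  Classical.epsilon_spec hu.2

theorem MemH1.memLp_weakGradient (hu : MemH1 Ω u) :
    MemLp (weakGradient Ω u) 2 (bulkMeasure Ω) :=
  hu.hasWeakGradient.1

theorem hasTrace_trace (hu : ∃ g, HasTrace Ω u g) : HasTrace Ω u (trace Ω u) :=
  Classical.epsilon_spec hu

theorem hasWeakLaplacian_weakLaplacian (hu : IsBulkRegular Ω u) :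
    HasWeakLaplacian Ω u (weakLaplacian Ω u) :=
  Classical.epsilon_spec hu.laplacian

theorem hasNormalDeriv_normalDeriv (hu : IsBulkRegular Ω u) :
    HasNormalDeriv Ω u (normalDeriv Ω u) :=
  Classical.epsilon_spec hu.normalDeriv

theorem MemH1Surface.hasSurfaceGradient (hv : MemH1Surface Ω v) :
    HasSurfaceGradient Ω v (surfaceGradient Ω v) :=
  Classical.epsilon_spec hv.2

theorem MemH1Surface.memLp_surfaceGradient (hv : MemH1Surface Ω v) :
    MemLp (surfaceGradient Ω v) 2 (surfaceMeasure Ω) :=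
  hv.hasSurfaceGradient.1

theorem hasLaplaceBeltrami_laplaceBeltrami (hv : IsSurfaceRegular Ω v) :
    HasLaplaceBeltrami Ω v (laplaceBeltrami Ω v) :=
  Classical.epsilon_spec hv.laplaceBeltrami

/-- Green's identity in `Ω`, tested with a function in `H¹(Ω)` that has a trace. -/
theorem integral_normalDeriv_mul (hu : IsBulkRegular Ω u) (hv : MemH1 Ω v)
    (hg : HasTrace Ω v g) :
    ∫ x, normalDeriv Ω u x * g x ∂(surfaceMeasure Ω) =
      (∫ x in Ω, inner ℝ (weakGradient Ω u x) (weakGradient Ω v x)) +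
        ∫ x in Ω, weakLaplacian Ω u x * v x := by
  obtain ⟨hgL, w, hw, hwv, hwgrad, hwg⟩ := hg
  have hgrad := hu.memH1.memLp_weakGradient
  have hlap := (hasWeakLaplacian_weakLaplacian hu).1
  have hmeas : ∀ j, AEStronglyMeasurable (w j) (bulkMeasure Ω) := fun j =>
    (hw j).continuous.aestronglyMeasurable
  have hmeas' : ∀ j, AEStronglyMeasurable (gradient (w j)) (bulkMeasure Ω) := fun j =>
    (continuous_gradient_of_contDiff (hw j)).aestronglyMeasurable
  have hbdry := tendsto_integral_mul (hasNormalDeriv_normalDeriv hu).1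
    (fun j => (hw j).continuous.aestronglyMeasurable) hgL hwg
  refine tendsto_nhds_unique hbdry (((tendsto_integral_inner hgrad hmeas' hv.memLp_weakGradient
    hwgrad).add (tendsto_integral_mul hlap hmeas hv.1 hwv)).congr' ?_)
  -- Splitting the integral of the sum needs both summands integrable, which holds only for large
  -- `j`.
  filter_upwards [eventually_memLp_of_tendsto hmeas hv.1 hwv,
    eventually_memLp_of_tendsto hmeas' hv.memLp_weakGradient hwgrad] with j hj hj'
  rw [(hasNormalDeriv_normalDeriv hu).2 (w j) (hw j),
    integral_add (integrable_inner_of_memLp hgrad hj') (integrable_mul_of_memLp hlap hj)]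

/-- Green's identity on `Γ`, tested with a function in `H¹(Γ)`. -/
theorem integral_laplaceBeltrami_mul (hu : IsSurfaceRegular Ω u)
    (hv : MemH1Surface Ω v) :
    ∫ x, laplaceBeltrami Ω u x * v x ∂(surfaceMeasure Ω) =
      - ∫ x, inner ℝ (surfaceGradient Ω u x) (surfaceGradient Ω v x) ∂(surfaceMeasure Ω) := by
  obtain ⟨hpL, w, hw, hwL, hwv, hwgrad⟩ := hv.hasSurfaceGradient
  refine tendsto_nhds_unique (tendsto_integral_mul (hasLaplaceBeltrami_laplaceBeltrami hu).1
    (fun j => (hw j).continuous.aestronglyMeasurable) hv.1 hwv)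
    ((tendsto_integral_inner hu.memH1.memLp_surfaceGradient (fun j => (hwL j).1) hpL
      hwgrad).neg.congr fun j => ?_)
  rw [(hasLaplaceBeltrami_laplaceBeltrami hu).2 (w j) (hw j)]

end Green

/-! ### Convexity and stabilization -/

section Energy

/-- Taylor's inequality for a function whose second derivative is bounded above. -/
theorem sub_le_of_deriv_deriv_le {W : ℝ → ℝ} (hW : ContDiff ℝ 2 W) {M : ℝ}
    (hM : ∀ ξ, deriv (deriv W) ξ ≤ M) (x y : ℝ) :
    W y - W x ≤ deriv W x * (y - x) + M / 2 * (y - x) ^ 2 := by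
  have hd : Differentiable ℝ W := hW.differentiable (by norm_num)
  have hd' : Differentiable ℝ (deriv W) :=
    (hW.iterate_deriv' 1 1).differentiable (by norm_num)
  -- Convex because its second derivative is `M - W'' ≥ 0`; the claim is that its graph lies above
  -- its tangent at `x`.
  set h : ℝ → ℝ := fun t => M / 2 * t ^ 2 - W t with hh
  have hh' : ∀ t, HasDerivAt h (M * t - deriv W t) t := fun t => by
    have := (((hasDerivAt_id t).pow 2).const_mul (M / 2)).sub (hd t).hasDerivAt
    refine (this.congr_deriv ?_)
    simp; ring
  have hderiv : deriv h = fun t => M * t - deriv W t := funext fun t => (hh' t).deriv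
  have hh'' : ∀ t, HasDerivAt (deriv h) (M - deriv (deriv W) t) t := fun t => by
    rw [hderiv]
    have := ((hasDerivAt_id t).const_mul M).sub (hd' t).hasDerivAt
    rw [mul_one] at this
    exact this
  have hconv : ConvexOn ℝ univ h :=
    convexOn_univ_of_deriv2_nonneg (fun t => (hh' t).differentiableAt)
      (fun t => (hh'' t).differentiableAt) fun t => by
        simp only [Function.iterate_succ, Function.iterate_zero, Function.comp_apply, id]
        rw [(hh'' t).deriv]
        linarith [hM t]
  have key : (M * x - deriv W x) * (y - x) ≤ h y - h x := by
    rcases lt_trichotomy x y with hxy | rfl | hxy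
    · have := hconv.le_slope_of_hasDerivAt (mem_univ x) (mem_univ y) hxy (hh' x)
      rwa [slope_def_field, le_div_iff₀ (sub_pos.2 hxy)] at this
    · simp
    · have := hconv.slope_le_of_hasDerivAt (mem_univ y) (mem_univ x) hxy (hh' x)
      rw [slope_def_field, div_le_iff₀ (sub_pos.2 hxy)] at this
      linarith
  simp only [hh] at key
  nlinarith [key]

/-- The energy balance of one stabilized step, for a measure that stands for volume in `Ω` or for
area on `Γ`: the convexity of the gradient term and the stabilization of the potential term. -/
theorem integral_energy_sub_le {α H : Type*} [MeasurableSpace α] {ν : Measure α}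
    [NormedAddCommGroup H] [InnerProductSpace ℝ H] {W : ℝ → ℝ} (hW : ContDiff ℝ 2 W)
    (hW2 : BddAbove (range (deriv (deriv W)))) {ε s b : ℝ} (hε : 0 < ε) (hb : 0 ≤ b)
    (hs : s ≥ 1 / (2 * ε) * ⨆ ξ : ℝ, deriv (deriv W) ξ) {u u' q : α → ℝ} {p p' : α → H}
    (hu : MemLp u 2 ν) (hu' : MemLp u' 2 ν) (hq : MemLp q 2 ν) (hp : MemLp p 2 ν)
    (hp' : MemLp p' 2 ν) (hWu : Integrable (fun x => W (u x)) ν)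
    (hWu' : Integrable (fun x => W (u' x)) ν)
    (heq : ∀ᵐ x ∂ν, q x = 1 / ε * deriv W (u x) + s * (u' x - u x)) :
    (∫ x, (1 / ε * W (u' x) + b / 2 * ‖p' x‖ ^ 2) ∂ν) -
        ∫ x, (1 / ε * W (u x) + b / 2 * ‖p x‖ ^ 2) ∂ν ≤
      ((∫ x, q x * u' x ∂ν) - ∫ x, q x * u x ∂ν) +
        b * ((∫ x, ‖p' x‖ ^ 2 ∂ν) - ∫ x, inner ℝ (p' x) (p x) ∂ν) := by
  have hn := (memLp_two_iff_integrable_sq_norm hp.1).1 hp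
  have hn' := (memLp_two_iff_integrable_sq_norm hp'.1).1 hp'
  have hi := integrable_inner_of_memLp hp' hp
  have hqu : Integrable (fun x => q x * u x) ν := integrable_mul_of_memLp hq hu
  have hqu' : Integrable (fun x => q x * u' x) ν := integrable_mul_of_memLp hq hu'
  have he : Integrable (fun x => 1 / ε * W (u x) + b / 2 * ‖p x‖ ^ 2) ν :=
    (hWu.const_mul _).add (hn.const_mul _)
  have he' : Integrable (fun x => 1 / ε * W (u' x) + b / 2 * ‖p' x‖ ^ 2) ν :=
    (hWu'.const_mul _).add (hn'.const_mul _)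
  have hqd : Integrable (fun x => q x * u' x - q x * u x) ν := hqu'.sub hqu
  have hpd : Integrable (fun x => b * (‖p' x‖ ^ 2 - inner ℝ (p' x) (p x))) ν :=
    (hn'.sub hi).const_mul b
  rw [← integral_sub hqu' hqu, ← integral_sub hn' hi, ← integral_const_mul,
    ← integral_sub he' he, ← integral_add hqd hpd]
  refine integral_mono_ae (he'.sub he) (hqd.add hpd) ?_
  filter_upwards [heq] with x hx
  -- `M` is the supremum itself. Boundedness is essential here: an unbounded real supremum would
  -- take the default value `0`.
  have htaylor := sub_le_of_deriv_deriv_le hW (fun ξ => le_ciSup hW2 ξ) (u x) (u' x)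
  have hpot : 1 / ε * (W (u' x) - W (u x)) ≤ q x * (u' x - u x) := by
    calc 1 / ε * (W (u' x) - W (u x))
        ≤ 1 / ε * (deriv W (u x) * (u' x - u x) +
            (⨆ ξ : ℝ, deriv (deriv W) ξ) / 2 * (u' x - u x) ^ 2) := by gcongr
      _ = 1 / ε * deriv W (u x) * (u' x - u x) +
            (1 / (2 * ε) * ⨆ ξ : ℝ, deriv (deriv W) ξ) * (u' x - u x) ^ 2 := by
          field_simp
      _ ≤ 1 / ε * deriv W (u x) * (u' x - u x) + s * (u' x - u x) ^ 2 := by gcongr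
      _ = q x * (u' x - u x) := by rw [hx]; ring
  -- Half of this expanded square is the gap in the convexity bound for the gradient term.
  have hgrad : 0 ≤ b * ‖p' x - p x‖ ^ 2 := by positivity
  rw [norm_sub_sq_real] at hgrad
  linarith

end Energy

/-! ### Energy balance of one time step -/

section Step

variable {d : ℕ} {Ω : Set (Space d)} {F G : ℝ → ℝ} {ε δ κ K s₁ s₂ τ : ℝ}
  {φ ψ φ' ψ' μ μΓ : Space d → ℝ}

/-- Lets Green's identity be used with `ψ` itself as boundary value, at the old state as well as the
new one; for the first step this is the compatibility of the initial data. -/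
theorem IsFiniteEnergyState.hasTrace (h : IsFiniteEnergyState Ω F G φ ψ) : HasTrace Ω φ ψ := by
  obtain ⟨hL, w, hw, h1, h2, h3⟩ := hasTrace_trace h.bulk_trace
  refine ⟨h.surface.1, w, hw, h1, h2, h3.congr fun j => eLpNorm_congr_ae ?_⟩
  filter_upwards [h.trace_eq] with x hx
  simp [hx]

theorem IsSchemeStep.bulk_energy_sub_le (h : IsSchemeStep Ω F G ε δ κ K s₁ s₂ τ φ ψ φ' ψ' μ μΓ)
    (hF : ContDiff ℝ 2 F) (hF2 : BddAbove (range (deriv (deriv F)))) (hε : 0 < ε)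
    (hs₁ : s₁ ≥ 1 / (2 * ε) * ⨆ ξ : ℝ, deriv (deriv F) ξ)
    (hst : IsFiniteEnergyState Ω F G φ ψ) (hst' : IsFiniteEnergyState Ω F G φ' ψ')
    (hφ' : IsBulkRegular Ω φ') (hμ : MemLp μ 2 (bulkMeasure Ω)) :
    (∫ x in Ω, ((1 / ε) * F (φ' x) + ε / 2 * ‖weakGradient Ω φ' x‖ ^ 2)) -
        ∫ x in Ω, ((1 / ε) * F (φ x) + ε / 2 * ‖weakGradient Ω φ x‖ ^ 2) ≤
      (∫ x in Ω, μ x * (φ' x - φ x)) +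
        ε * ∫ x, normalDeriv Ω φ' x * (ψ' x - ψ x) ∂(surfaceMeasure Ω) := by
  have hlap := (hasWeakLaplacian_weakLaplacian hφ').1
  have hnd := (hasNormalDeriv_normalDeriv hφ').1
  -- By the potential equation this is the explicit potential term plus the stabilization.
  have hq : MemLp (fun x => μ x + ε * weakLaplacian Ω φ' x) 2 (bulkMeasure Ω) :=
    hμ.add (hlap.const_mul ε)
  have key := integral_energy_sub_le hF hF2 hε hε.le hs₁ hst.bulk.1 hst'.bulk.1 hq
    hst.bulk.memLp_weakGradient hst'.bulk.memLp_weakGradient hst.bulk_potential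
    hst'.bulk_potential (by filter_upwards [h.bulk_potential] with x hx; linarith)
  have hsplit : ∀ {v : Space d → ℝ}, MemLp v 2 (bulkMeasure Ω) →
      ∫ x in Ω, (μ x + ε * weakLaplacian Ω φ' x) * v x =
        (∫ x in Ω, μ x * v x) + ε * ∫ x in Ω, weakLaplacian Ω φ' x * v x := fun {v} hv => by
    rw [← integral_const_mul, ← integral_add (integrable_mul_of_memLp hμ hv)
      ((integrable_mul_of_memLp hlap hv).const_mul ε)]
    exact integral_congr_ae (Eventually.of_forall fun x => by simp only; ring)
  have green := integral_normalDeriv_mul hφ' hst.bulk hst.hasTrace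
  have green' := integral_normalDeriv_mul hφ' hst'.bulk hst'.hasTrace
  simp only [real_inner_self_eq_norm_sq] at green'
  simp only [mul_sub]
  rw [integral_sub (integrable_mul_of_memLp hμ hst'.bulk.1) (integrable_mul_of_memLp hμ hst.bulk.1),
    integral_sub (integrable_mul_of_memLp hnd hst'.surface.1)
      (integrable_mul_of_memLp hnd hst.surface.1),
    green, green']
  rw [hsplit hst.bulk.1, hsplit hst'.bulk.1] at key
  linarith

/-- The term with `normalDeriv Ω φ'` has the opposite sign to that in `bulk_energy_sub_le`, so it
drops out of the sum. -/
theorem IsSchemeStep.surface_energy_sub_le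
    (h : IsSchemeStep Ω F G ε δ κ K s₁ s₂ τ φ ψ φ' ψ' μ μΓ)
    (hG : ContDiff ℝ 2 G) (hG2 : BddAbove (range (deriv (deriv G)))) (hδ : 0 < δ) (hκ : 0 ≤ κ)
    (hs₂ : s₂ ≥ 1 / (2 * δ) * ⨆ η : ℝ, deriv (deriv G) η)
    (hst : IsFiniteEnergyState Ω F G φ ψ) (hst' : IsFiniteEnergyState Ω F G φ' ψ')
    (hφ' : IsBulkRegular Ω φ') (hψ' : IsSurfaceRegular Ω ψ')
    (hμΓ : MemLp μΓ 2 (surfaceMeasure Ω)) :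
    (∫ x, ((1 / δ) * G (ψ' x) + δ * κ / 2 * ‖surfaceGradient Ω ψ' x‖ ^ 2) ∂(surfaceMeasure Ω)) -
        ∫ x, ((1 / δ) * G (ψ x) + δ * κ / 2 * ‖surfaceGradient Ω ψ x‖ ^ 2) ∂(surfaceMeasure Ω) ≤
      (∫ x, μΓ x * (ψ' x - ψ x) ∂(surfaceMeasure Ω)) -
        ε * ∫ x, normalDeriv Ω φ' x * (ψ' x - ψ x) ∂(surfaceMeasure Ω) := by
  have hlap := (hasLaplaceBeltrami_laplaceBeltrami hψ').1
  have hnd := (hasNormalDeriv_normalDeriv hφ').1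
  have hq : MemLp (fun x => μΓ x + δ * κ * laplaceBeltrami Ω ψ' x - ε * normalDeriv Ω φ' x) 2
      (surfaceMeasure Ω) := (hμΓ.add (hlap.const_mul (δ * κ))).sub (hnd.const_mul ε)
  have key := integral_energy_sub_le hG hG2 hδ (mul_nonneg hδ.le hκ) hs₂ hst.surface.1
    hst'.surface.1 hq hst.surface.memLp_surfaceGradient hst'.surface.memLp_surfaceGradient
    hst.surface_potential hst'.surface_potential
    (by filter_upwards [h.surface_potential] with x hx; linarith)
  have hsplit : ∀ {v : Space d → ℝ}, MemLp v 2 (surfaceMeasure Ω) →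
      ∫ x, (μΓ x + δ * κ * laplaceBeltrami Ω ψ' x - ε * normalDeriv Ω φ' x) * v x
          ∂(surfaceMeasure Ω) =
        (∫ x, μΓ x * v x ∂(surfaceMeasure Ω)) +
          δ * κ * (∫ x, laplaceBeltrami Ω ψ' x * v x ∂(surfaceMeasure Ω)) -
          ε * ∫ x, normalDeriv Ω φ' x * v x ∂(surfaceMeasure Ω) := fun {v} hv => by
    rw [← integral_const_mul, ← integral_const_mul,
      ← integral_add (integrable_mul_of_memLp hμΓ hv)
        ((integrable_mul_of_memLp hlap hv).const_mul (δ * κ)), ← integral_sub ?_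
        ((integrable_mul_of_memLp hnd hv).const_mul ε)]
    rotate_left
    · exact (integrable_mul_of_memLp hμΓ hv).add
        ((integrable_mul_of_memLp hlap hv).const_mul (δ * κ))
    exact integral_congr_ae (Eventually.of_forall fun x => by simp only; ring)
  have green := integral_laplaceBeltrami_mul hψ' hst.surface
  have green' := integral_laplaceBeltrami_mul hψ' hst'.surface
  simp only [real_inner_self_eq_norm_sq] at green'
  simp only [mul_sub]
  rw [integral_sub (integrable_mul_of_memLp hμΓ hst'.surface.1)
      (integrable_mul_of_memLp hμΓ hst.surface.1),
    integral_sub (integrable_mul_of_memLp hnd hst'.surface.1)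
      (integrable_mul_of_memLp hnd hst.surface.1)]
  rw [hsplit hst.surface.1, hsplit hst'.surface.1, green, green'] at key
  linarith

theorem IsSchemeStep.integral_mul_bulk_increment
    (h : IsSchemeStep Ω F G ε δ κ K s₁ s₂ τ φ ψ φ' ψ' μ μΓ) (hτ : 0 < τ)
    (hμ : IsBulkRegular Ω μ) :
    ∫ x in Ω, μ x * (φ' x - φ x) =
      τ * ((∫ x, normalDeriv Ω μ x * trace Ω μ x ∂(surfaceMeasure Ω)) -
        ∫ x in Ω, ‖weakGradient Ω μ x‖ ^ 2) := by
  have green := integral_normalDeriv_mul hμ hμ.memH1 (hasTrace_trace hμ.trace)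
  simp only [real_inner_self_eq_norm_sq] at green
  rw [green, add_sub_cancel_left, ← integral_const_mul]
  refine integral_congr_ae ?_
  filter_upwards [h.bulk_evolution] with x hx
  rw [← hx]
  field_simp

theorem IsSchemeStep.integral_mul_surface_increment
    (h : IsSchemeStep Ω F G ε δ κ K s₁ s₂ τ φ ψ φ' ψ' μ μΓ) (hτ : 0 < τ)
    (hμ : IsBulkRegular Ω μ) (hμΓ : IsSurfaceRegular Ω μΓ) :
    ∫ x, μΓ x * (ψ' x - ψ x) ∂(surfaceMeasure Ω) =
      τ * (- (∫ x, ‖surfaceGradient Ω μΓ x‖ ^ 2 ∂(surfaceMeasure Ω)) -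
        ∫ x, normalDeriv Ω μ x * μΓ x ∂(surfaceMeasure Ω)) := by
  have green := integral_laplaceBeltrami_mul hμΓ hμΓ.memH1
  simp only [real_inner_self_eq_norm_sq] at green
  rw [← green, ← integral_sub (integrable_mul_of_memLp (hasLaplaceBeltrami_laplaceBeltrami hμΓ).1
      hμΓ.memH1.1)
    (integrable_mul_of_memLp (hasNormalDeriv_normalDeriv hμ).1 hμΓ.memH1.1), ← integral_const_mul]
  refine integral_congr_ae ?_
  filter_upwards [h.surface_evolution] with x hx
  rw [div_eq_iff hτ.ne'] at hx
  rw [hx]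
  ring

/-- The boundary terms left by the two evolution equations combine into the flux times the jump; by
the Robin condition the flux is `-1/K` times that jump. -/
theorem IsSchemeStep.integral_normalDeriv_mul_jump
    (h : IsSchemeStep Ω F G ε δ κ K s₁ s₂ τ φ ψ φ' ψ' μ μΓ) (hK : 0 < K)
    (hμ : IsBulkRegular Ω μ) (hμΓ : MemLp μΓ 2 (surfaceMeasure Ω)) :
    (∫ x, normalDeriv Ω μ x * trace Ω μ x ∂(surfaceMeasure Ω)) -
        ∫ x, normalDeriv Ω μ x * μΓ x ∂(surfaceMeasure Ω) =
      - (1 / K * ∫ x, (trace Ω μ x - μΓ x) ^ 2 ∂(surfaceMeasure Ω)) := by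
  rw [← integral_sub (integrable_mul_of_memLp (hasNormalDeriv_normalDeriv hμ).1
      (hasTrace_trace hμ.trace).1)
    (integrable_mul_of_memLp (hasNormalDeriv_normalDeriv hμ).1 hμΓ),
    ← integral_const_mul, ← integral_neg]
  refine integral_congr_ae ?_
  filter_upwards [h.robin] with x hx
  have hn : normalDeriv Ω μ x = (μΓ x - trace Ω μ x) / K := by
    rw [eq_div_iff hK.ne']
    linarith
  rw [hn]
  field_simp
  ring

end Step

end CahnHilliard

theorem theorem1 {d k : ℕ} (hd : d = 2 ∨ d = 3) (hk : 1 ≤ k)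
    (Ω : Set (Space d)) (hΩ : IsBoundedDomainOfClass k Ω)
    (F G : ℝ → ℝ) (hF : ContDiff ℝ 2 F) (hG : ContDiff ℝ 2 G)
    (hF2 : BddAbove (Set.range (deriv (deriv F)))) (hG2 : BddAbove (Set.range (deriv (deriv G))))
    (ε δ κ K s₁ s₂ T : ℝ) (hε : 0 < ε) (hδ : 0 < δ) (hκ : 0 ≤ κ) (hK : 0 < K) (hT : 0 < T)
    (hs₁ : s₁ ≥ 1 / (2 * ε) * ⨆ ξ : ℝ, deriv (deriv F) ξ)
    (hs₂ : s₂ ≥ 1 / (2 * δ) * ⨆ η : ℝ, deriv (deriv G) η)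
    (N : ℕ) (hN : 0 < N) (τ : ℝ) (hτ : τ = T / N)
    (φ ψ μ μΓ : ℕ → Space d → ℝ)
    (hsol : IsSchemeSolution Ω F G ε δ κ K s₁ s₂ τ N φ ψ μ μΓ) :
    ∀ n < N,
      (energy Ω F G ε δ κ (φ (n + 1)) (ψ (n + 1)) - energy Ω F G ε δ κ (φ n) (ψ n)) / τ ≤
          - (∫ x in Ω, ‖weakGradient Ω (μ (n + 1)) x‖ ^ 2)
          - (∫ x, ‖surfaceGradient Ω (μΓ (n + 1)) x‖ ^ 2 ∂(surfaceMeasure Ω))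
          - 1 / K * (∫ x, (trace Ω (μ (n + 1)) x - μΓ (n + 1) x) ^ 2 ∂(surfaceMeasure Ω)) ∧
      energy Ω F G ε δ κ (φ (n + 1)) (ψ (n + 1)) ≤ energy Ω F G ε δ κ (φ n) (ψ n) := by
  intro n hn
  have hτ' : 0 < τ := by rw [hτ]; positivity
  have hst := hsol.state n hn.le
  have hst' := hsol.state (n + 1) hn
  have hφ' := hsol.phi_regular n hn
  have hμ := hsol.mu_regular n hn
  have hμΓ := hsol.muΓ_regular n hn
  have hstep := hsol.step n hn
  have hbulk := hstep.bulk_energy_sub_le hF hF2 hε hs₁ hst hst' hφ' hμ.memH1.1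
  have hsurf := hstep.surface_energy_sub_le hG hG2 hδ hκ hs₂ hst hst' hφ'
    (hsol.psi_regular n hn) hμΓ.memH1.1
  rw [hstep.integral_mul_bulk_increment hτ' hμ] at hbulk
  rw [hstep.integral_mul_surface_increment hτ' hμ hμΓ] at hsurf
  have hrobin := hstep.integral_normalDeriv_mul_jump hK hμ hμΓ.memH1.1
  have hdiss : (energy Ω F G ε δ κ (φ (n + 1)) (ψ (n + 1)) - energy Ω F G ε δ κ (φ n) (ψ n)) / τ ≤
      - (∫ x in Ω, ‖weakGradient Ω (μ (n + 1)) x‖ ^ 2)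
      - (∫ x, ‖surfaceGradient Ω (μΓ (n + 1)) x‖ ^ 2 ∂(surfaceMeasure Ω))
      - 1 / K * (∫ x, (trace Ω (μ (n + 1)) x - μΓ (n + 1) x) ^ 2 ∂(surfaceMeasure Ω)) := by
    rw [div_le_iff₀ hτ', energy, energy]
    -- Scaled by `τ` so that the balance is linear in the products of `τ` with the integrals.
    have hrobin' := congrArg (fun t => τ * t) hrobin
    linarith
  refine ⟨hdiss, ?_⟩
  have h₁ : 0 ≤ ∫ x in Ω, ‖weakGradient Ω (μ (n + 1)) x‖ ^ 2 :=
    integral_nonneg fun _ => by positivity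
  have h₂ : 0 ≤ ∫ x, ‖surfaceGradient Ω (μΓ (n + 1)) x‖ ^ 2 ∂(surfaceMeasure Ω) :=
    integral_nonneg fun _ => by positivity
  have h₃ : 0 ≤ 1 / K * ∫ x, (trace Ω (μ (n + 1)) x - μΓ (n + 1) x) ^ 2 ∂(surfaceMeasure Ω) :=
    mul_nonneg (by positivity) (integral_nonneg fun _ => by positivity)
  have hle := hdiss.trans (by linarith : _ ≤ (0 : ℝ))
  rw [div_le_iff₀ hτ', zero_mul] at hle
  linarith
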